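/- Let $\mathbb K$ be a commutative ring. For a $\mathbb K$-module $V$ put $\mathscr F(V)=\bigoplus_{n\ge 0}\mathscr F_n(V)$ with $\mathscr F_n(V)=V^{\otimes n}\otimes\mathbb K\mathfrak S_n$, and write $t\#\sigma$ for $t\otimes\sigma$ ($t\in V^{\otimes n}$, $\sigma\in\mathfrak S_n$). For $\pi\in\mathfrak S_n$ let $\pi(v_1\otimes\cdots\otimes v_n)=v_{\pi^{-1}(1)}\otimes\cdots\otimes v_{\pi^{-1}(n)}$ and $\pi\cdot(t\#\sigma)=\pi(t)\#\pi\sigma$. The external product on $\mathscr F(V)$ is the bilinear associative product, with unit $1\in\mathbb K=\mathscr F_0(V)$, given for $t\in V^{\otimes m}$, $\sigma\in\mathfrak S_m$, $t'\in V^{\otimes n}$, $\sigma'\in\mathfrak S_n$ by $$(t\#\sigma)*(t'\#\sigma')=\sum_{\rho}\rho\cdot\bigl((t\otimes t')\#(\sigma\times\sigma')\bigr),$$ where $\rho$ runs over the permutations of $\{1,\dots,m+n\}$ that are increasing on $\{1,\dots,m\}$ and on $\{m+1,\dots,m+n\}$. If $A$ is a $\mathbb K$-algebra, the internal product on $\mathscr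 F(A)$ is the bilinear product for which $\mathscr F_m(A)\cdot\mathscr F_n(A)=0$ if $m\ne n$, and $(t\#\sigma)\cdot(u\#\tau)=\bigl(t\,\sigma(u)\bigr)\#\sigma\tau$ for $t,u\in A^{\otimes n}$, $\sigma,\tau\in\mathfrak S_n$. If $V$ is a coalgebra with coproduct $\delta$ and counit $\varepsilon$, let $\delta_0=\varepsilon$, $\delta_{n+1}=(\delta_n\otimes\mathrm{id})\circ\delta$ (so that $\delta_1=\mathrm{id}$ and $\delta_2=\delta$) be the iterated coproducts $\delta_n:V\to V^{\otimes n}$, and put $y_{n,v}=\delta_n(v)\#e_n\in\mathscr F_n(V)$ for $n\ge 0$ and $v\in V$, where $e_n$ is the unit of $\mathfrak S_n$. Let $A$ be a cocommutative $\mathbb K$-bialgebra, let $n$ be a positive integer, let $\mathbf c=(c_1,\dots,c_k)$ and $\mathbf d=(d_1,\dots,d_l)$ be two compositions of $n$ (sequences of positive integers with sum $n$), and let $a_1,\dots,a_k,b_1,\dots,b_l\in A$. Let $\mathscr M_{\mathbf c,\mathbf d}$ be the set of $k\times l$ matrices $M=(m_{ij})$ with non-negative integer entries such that $\sum_j m_{ij}=c_i$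 for all $i$ and $\sum_i m_{ij}=d_j$ for all $j$. Then $$(y_{c_1,a_1}*\cdots*y_{c_k,a_k})\cdot(y_{d_1,b_1}*\cdots*y_{d_l,b_l})=\sum_{(a_i),(b_j)}\ \sum_{M\in\mathscr M_{\mathbf c,\mathbf d}}\Bigl(\prod_{j=1}^{l}\prod_{i=1}^{k}y_{m_{ij},\,a_{i(j)}b_{j(i)}}\Bigr),$$ where the first sum is Sweedler notation for the iterated coproducts $\delta_l(a_i)=\sum_{(a_i)}a_{i(1)}\otimes\cdots\otimes a_{i(l)}$ and $\delta_k(b_j)=\sum_{(b_j)}b_{j(1)}\otimes\cdots\otimes b_{j(k)}$ (any decompositions into finite sums of pure tensors may be used), and the products $\prod$ are ordered external products, the entries of $M$ being read column by column: $j=1,\dots,l$ and, within each $j$, $i=1,\dots,k$. -/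

import Mathlib

open scoped TensorProduct DirectSum

noncomputable section

namespace FreeQSym

/-! ### The modules `F_n(V)` and `F(V)` -/

/-- `F_n(V) = V^{⊗ n} # K𝔖_n`. The group algebra `K𝔖_n` is free on `𝔖_n`, so that
`V^{⊗ n} ⊗ K𝔖_n` is the module of formal sums `∑_σ t_σ # σ` with `t_σ ∈ V^{⊗ n}`; the finitely
supported function `σ ↦ t_σ` stands for this formal sum. -/
def Comp (K V : Type*) [CommSemiring K] [AddCommMonoid V] [Module K V] (n : ℕ) : Type _ :=
  Equiv.Perm (Fin n) →₀ ⨂[K]^n V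

section Module

variable {K V : Type*} [CommSemiring K] [AddCommMonoid V] [Module K V]

instance (n : ℕ) : AddCommMonoid (Comp K V n) :=
  inferInstanceAs (AddCommMonoid (Equiv.Perm (Fin n) →₀ ⨂[K]^n V))

instance (n : ℕ) : Module K (Comp K V n) :=
  inferInstanceAs (Module K (Equiv.Perm (Fin n) →₀ ⨂[K]^n V))

/-- The element `t # σ` of `F_n(V)`; it is additive in the tensor `t`. -/
def sharp {n : ℕ} (σ : Equiv.Perm (Fin n)) : ⨂[K]^n V →+ Comp K V n :=
  Finsupp.singleAddHom σ

/-- The coefficient `t_σ` of `∑_σ t_σ # σ`. -/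
def coeff {n : ℕ} (σ : Equiv.Perm (Fin n)) : Comp K V n →+ ⨂[K]^n V :=
  Finsupp.applyAddHom σ

theorem coeff_sharp {n : ℕ} (σ τ : Equiv.Perm (Fin n)) (t : ⨂[K]^n V) :
    coeff τ (sharp σ t) = if σ = τ then t else 0 := by
  classical
  exact (Finsupp.single_apply).trans (by congr)

theorem sum_sharp_coeff {n : ℕ} (α : Comp K V n) : ∑ σ, sharp σ (coeff σ α) = α :=
  Finsupp.univ_sum_single α

/-- The place permutation
`π • (v_1 ⊗ ⋯ ⊗ v_n) = v_{π⁻¹(1)} ⊗ ⋯ ⊗ v_{π⁻¹(n)}` on `V^{⊗ n}`. -/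
def permTensor {n : ℕ} (π : Equiv.Perm (Fin n)) : ⨂[K]^n V ≃ₗ[K] ⨂[K]^n V :=
  PiTensorProduct.reindex K (fun _ => V) π

theorem permTensor_tprod {n : ℕ} (π : Equiv.Perm (Fin n)) (v : Fin n → V) :
    permTensor π (PiTensorProduct.tprod K v) = PiTensorProduct.tprod K fun i => v (π⁻¹ i) :=
  PiTensorProduct.reindex_tprod _ _

/-- The juxtaposition `V^{⊗ m} × V^{⊗ n} → V^{⊗ (m + n)}` of tensors. -/
def concat {m n : ℕ} (t : ⨂[K]^m V) (u : ⨂[K]^n V) : ⨂[K]^(m + n) V :=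
  TensorPower.mulEquiv (t ⊗ₜ[K] u)

theorem concat_tprod {m n : ℕ} (v : Fin m → V) (w : Fin n → V) :
    concat (PiTensorProduct.tprod K v) (PiTensorProduct.tprod K w) =
      PiTensorProduct.tprod K (Fin.append v w) :=
  TensorPower.tprod_mul_tprod K v w

end Module

/-! ### The external product -/

/-- The permutation `σ × σ'` of `{1, …, m + n}`: `σ` acts on the first `m` letters and
`σ'` on the last `n` letters. -/
def permProd {m n : ℕ} (σ : Equiv.Perm (Fin m)) (σ' : Equiv.Perm (Fin n)) :
    Equiv.Perm (Fin (m + n)) :=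
  finSumFinEquiv.permCongr (Equiv.Perm.sumCongr σ σ')

open Classical in
/-- The set `X_{(m,n)}` of the permutations of `{1, …, m + n}` which are increasing on
`{1, …, m}` and on `{m + 1, …, m + n}`. -/
def shuffles (m n : ℕ) : Finset (Equiv.Perm (Fin (m + n))) :=
  Finset.univ.filter fun ρ =>
    StrictMono (fun i : Fin m => ρ (Fin.castAdd n i)) ∧
      StrictMono (fun j : Fin n => ρ (Fin.natAdd m j))

section External

variable {K V : Type*} [CommSemiring K] [AddCommMonoid V] [Module K V]

/-- The external product `F_m(V) × F_n(V) → F_{m+n}(V)`: the biadditive extension of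
`(t # σ) * (u # σ') = x_{(m,n)} · ((t ⊗ u) # (σ × σ'))`, where `x_{(m,n)}` is the sum of
the elements of `X_{(m,n)}` and `ρ · (t # σ) = (ρ • t) # ρσ`. -/
def extProd {m n : ℕ} (α : Comp K V m) (β : Comp K V n) : Comp K V (m + n) :=
  ∑ σ : Equiv.Perm (Fin m), ∑ σ' : Equiv.Perm (Fin n), ∑ ρ ∈ shuffles m n,
    sharp (ρ * permProd σ σ') (permTensor ρ (concat (coeff σ α) (coeff σ' β)))

theorem extProd_sharp {m n : ℕ} (σ : Equiv.Perm (Fin m)) (σ' : Equiv.Perm (Fin n))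
    (t : ⨂[K]^m V) (u : ⨂[K]^n V) :
    extProd (sharp σ t) (sharp σ' u) =
      ∑ ρ ∈ shuffles m n, sharp (ρ * permProd σ σ') (permTensor ρ (concat t u)) := by
  classical
  rw [extProd, Finset.sum_eq_single σ, Finset.sum_eq_single σ']
  · simp [coeff_sharp]
  · intro τ _ h
    simp [coeff_sharp, h.symm, concat]
  · simp
  · intro τ _ h
    simp [coeff_sharp, h.symm, concat]
  · simp

/-- The external product on `F(V) = ⨁ n, F_n(V)` is the multiplication `*` of this direct sum. -/
instance : DirectSum.GNonUnitalNonAssocSemiring (fun n => Comp K V n) where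
  mul := extProd
  mul_zero a := by simp [extProd, concat]
  zero_mul b := by simp [extProd, concat]
  mul_add a b c := by simp [extProd, concat, TensorProduct.tmul_add, Finset.sum_add_distrib]
  add_mul a b c := by simp [extProd, concat, TensorProduct.add_tmul, Finset.sum_add_distrib]

/-- The unit of `F(V)` is the unit of `F_0(V) = K`. -/
instance : GradedMonoid.GOne (fun n => Comp K V n) where
  one := sharp 1 (PiTensorProduct.tprod K Fin.elim0)

end External

end FreeQSym

/-- The free quasisymmetric module `F(V) = ⨁ n, F_n(V)`. Its multiplication `*` is the external
product and its `1` is the unit of the external product. -/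
abbrev FreeQSym (K V : Type*) [CommSemiring K] [AddCommMonoid V] [Module K V] : Type _ :=
  ⨁ n : ℕ, FreeQSym.Comp K V n

namespace FreeQSym

theorem of_mul_of {K V : Type*} [CommSemiring K] [AddCommMonoid V] [Module K V] {m n : ℕ}
    (α : Comp K V m) (β : Comp K V n) :
    (DirectSum.of (fun n => Comp K V n) m α * DirectSum.of (fun n => Comp K V n) n β :
      FreeQSym K V) = DirectSum.of (fun n => Comp K V n) (m + n) (extProd α β) :=
  DirectSum.of_mul_of α β

theorem one_eq {K V : Type*} [CommSemiring K] [AddCommMonoid V] [Module K V] :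
    (1 : FreeQSym K V) =
      DirectSum.of (fun n => Comp K V n) 0 (sharp 1 (PiTensorProduct.tprod K Fin.elim0)) :=
  rfl

/-! ### The internal product -/

section Internal

variable {K A : Type*} [CommSemiring K] [Semiring A] [Algebra K A]

/-- The product of the twisted group ring `F_n(A) = A^{⊗ n} # K𝔖_n`: the biadditive extension of
`(t # σ) · (u # τ) = (t (σ • u)) # στ`. -/
def twistedProd {n : ℕ} (α β : Comp K A n) : Comp K A n :=
  ∑ σ : Equiv.Perm (Fin n), ∑ τ : Equiv.Perm (Fin n),
    sharp (σ * τ) (coeff σ α * permTensor σ (coeff τ β))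

theorem twistedProd_sharp_tprod {n : ℕ} (σ τ : Equiv.Perm (Fin n)) (a b : Fin n → A) :
    twistedProd (sharp σ (PiTensorProduct.tprod K a)) (sharp τ (PiTensorProduct.tprod K b)) =
      sharp (σ * τ) (PiTensorProduct.tprod K fun i => a i * b (σ⁻¹ i)) := by
  classical
  rw [twistedProd, Finset.sum_eq_single σ, Finset.sum_eq_single τ]
  · simp only [coeff_sharp, if_true, permTensor_tprod, PiTensorProduct.tprod_mul_tprod]
    rfl
  · intro τ _ h
    simp [coeff_sharp, h.symm]
  · simp
  · intro τ _ h
    simp [coeff_sharp, h.symm]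
  · simp

/-- The internal product on `F(A)`: `(∑ α_n) · (∑ β_n) = ∑ α_n · β_n`. -/
def internalProd (α β : FreeQSym K A) : FreeQSym K A :=
  DFinsupp.zipWith (fun _ x y => twistedProd x y) (fun _ => by simp [twistedProd]) α β

theorem internalProd_apply (α β : FreeQSym K A) (n : ℕ) :
    internalProd α β n = twistedProd (α n) (β n) :=
  DFinsupp.zipWith_apply _ _ _ _ _

end Internal

/-! ### Iterated coproducts and the elements `y_{n,v}` -/

section Coalgebra

variable (K : Type*) {V : Type*} [CommSemiring K] [AddCommMonoid V] [Module K V] [Coalgebra K V]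

/-- The iterated coproduct `δ_n : V → V^{⊗ n}` of a coalgebra: `δ_0` is the counit and
`δ_{n+1} = (δ_n ⊗ id) ∘ δ`; in particular `δ_1 = id`, `δ_2 = δ`, `δ_3 = (δ ⊗ id) ∘ δ`. -/
def iterComul : (n : ℕ) → V →ₗ[K] ⨂[K]^n V
  | 0 => TensorPower.algebraMap₀.toLinearMap ∘ₗ Coalgebra.counit
  | n + 1 => TensorPower.mulEquiv.toLinearMap ∘ₗ
      TensorProduct.map (iterComul n) (PiTensorProduct.subsingletonEquiv (0 : Fin 1)).symm.toLinearMap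
      ∘ₗ Coalgebra.comul

theorem iterComul_one (v : V) : iterComul K 1 v = PiTensorProduct.tprod K fun _ => v := by
  have r := Coalgebra.Repr.arbitrary K v
  have key : ∀ x w : V, TensorPower.mulEquiv
      ((TensorPower.algebraMap₀ (Coalgebra.counit (R := K) x) : ⨂[K]^0 V) ⊗ₜ[K]
        (PiTensorProduct.tprod K fun _ : Fin 1 => w)) =
      (PiTensorProduct.subsingletonEquiv (R := K) (s := fun _ => V) (0 : Fin 1)).symm
        (Coalgebra.counit (R := K) x • w) := by
    intro x w
    have h : concat (PiTensorProduct.tprod K (Fin.elim0 : Fin 0 → V)) (PiTensorProduct.tprod K fun _ : Fin 1 => w)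
        = PiTensorProduct.tprod K fun _ : Fin (0 + 1) => w := by
      refine (concat_tprod (K := K) (Fin.elim0 : Fin 0 → V) (fun _ : Fin 1 => w)).trans ?_
      congr 1
      funext i
      rw [show i = Fin.natAdd 0 (0 : Fin 1) from Fin.ext (by have := i.isLt; simp)]
      exact Fin.append_right (Fin.elim0 : Fin 0 → V) (fun _ : Fin 1 => w) 0
    rw [TensorPower.algebraMap₀_eq_smul_one, map_smul,
      PiTensorProduct.subsingletonEquiv_symm_apply']
    refine Eq.trans ?_ (congrArg (fun t => Coalgebra.counit (R := K) x • t) h)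
    exact map_smul TensorPower.mulEquiv (Coalgebra.counit (R := K) x)
      ((PiTensorProduct.tprod K (Fin.elim0 : Fin 0 → V)) ⊗ₜ[K]
        (PiTensorProduct.tprod K fun _ : Fin 1 => w))
  simp only [iterComul, LinearMap.comp_apply, ← r.eq, map_sum, TensorProduct.map_tmul,
    LinearEquiv.coe_coe, PiTensorProduct.subsingletonEquiv_symm_apply']
  simp only [key]
  rw [← map_sum, Coalgebra.sum_counit_smul r, PiTensorProduct.subsingletonEquiv_symm_apply']

theorem iterComul_two {ι : Type*} (v : V) (r : Finset ι) (x w : ι → V)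
    (h : Coalgebra.comul (R := K) v = ∑ i ∈ r, x i ⊗ₜ[K] w i) :
    iterComul K 2 v = ∑ i ∈ r, PiTensorProduct.tprod K ![x i, w i] := by
  rw [iterComul]
  simp only [LinearMap.comp_apply, h, map_sum, TensorProduct.map_tmul,
    LinearEquiv.coe_coe, PiTensorProduct.subsingletonEquiv_symm_apply', iterComul_one]
  refine Finset.sum_congr rfl fun i _ => ?_
  refine (concat_tprod (K := K) (fun _ : Fin 1 => x i) (fun _ : Fin 1 => w i)).trans ?_
  congr 1
  funext j
  fin_cases j <;> rfl

/-- A Sweedler decomposition `δ_n(v) = ∑_s v_{(1)}(s) ⊗ ⋯ ⊗ v_{(n)}(s)` of an iterated coproduct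
into a finite sum of pure tensors. It exists for every `n ≥ 1`, see `Sweedler.exists`. -/
structure Sweedler (n : ℕ) (v : V) where
  /-- the number of terms -/
  size : ℕ
  /-- `term s j` is the `j`-th factor `v_{(j)}(s)` of the `s`-th term -/
  term : Fin size → Fin n → V
  eq : iterComul K n v = ∑ s, PiTensorProduct.tprod K (term s)

theorem Sweedler.exists {n : ℕ} (hn : 0 < n) (v : V) : Nonempty (Sweedler K n v) := by
  obtain ⟨l, hl⟩ : ∃ l : List (Fin n → V),
      iterComul K n v = (l.map fun f => PiTensorProduct.tprod K f).sum := by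
    generalize iterComul K n v = t
    induction t using PiTensorProduct.induction_on with
    | smul_tprod r f =>
      refine ⟨[Function.update f ⟨0, hn⟩ (r • f ⟨0, hn⟩)], ?_⟩
      simp [MultilinearMap.map_update_smul]
    | add x y hx hy =>
      obtain ⟨l, rfl⟩ := hx
      obtain ⟨m, rfl⟩ := hy
      exact ⟨l ++ m, by simp⟩
  refine ⟨⟨l.length, fun s => l[s], ?_⟩⟩
  rw [hl]
  exact (Fin.sum_univ_fun_getElem l fun f => PiTensorProduct.tprod K f).symm

/-- The element `y_{n,v} = δ_n(v) # e_n` of `F(V)`; in particular `y_{0,v} = ε(v)`. -/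
def y (n : ℕ) (v : V) : FreeQSym K V :=
  DirectSum.of (fun n => Comp K V n) n (sharp 1 (iterComul K n v))

end Coalgebra

/-! ### Matrices with prescribed margins -/

/-- The set `M_{c,d}` of the matrices with non-negative integral entries, with row sums `c` and
column sums `d`. -/
def marginMatrices {k l : ℕ} (c : Fin k → ℕ) (d : Fin l → ℕ) : Finset (Matrix (Fin k) (Fin l) ℕ) :=
  (Fintype.piFinset fun i => Finset.piAntidiag Finset.univ (c i)).filter
    fun M => ∀ j, ∑ i, M i j = d j

theorem mem_marginMatrices {k l : ℕ} (c : Fin k → ℕ) (d : Fin l → ℕ)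
    (M : Matrix (Fin k) (Fin l) ℕ) :
    M ∈ marginMatrices c d ↔ (∀ i, ∑ j, M i j = c i) ∧ ∀ j, ∑ i, M i j = d j := by
  refine Finset.mem_filter.trans (and_congr_left' ?_)
  exact Fintype.mem_piFinset.trans (by simp [Finset.mem_piAntidiag])

end FreeQSym

end

/-!
Let `Λ` be a totally ordered alphabet, and let each letter `x` carry a label `a x ∈ A`. A word `f`
of length `n` over `Λ` defines a tensor `t_f ∈ A^{⊗ n}`, which has the factors of the iterated
coproduct of `a x` at the positions of the letter `x`, and a permutation `σ_f`, which sorts the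
positions of `f` stably. The order in which the factors of an iterated coproduct are placed does not
matter since `A` is cocommutative.

The external product of the `y_{c x, a x}`, in increasing order of the letters, is the sum of
`t_f # σ_f` over the words `f` in which each letter `x` occurs `c x` times: a shuffle is a way of
merging two words over disjoint alphabets.

The internal product then becomes a sum over pairs of words `(f, g)`. Sorting by `f` and afterwards
by `g` is sorting lexicographically by `g` and `f`, so that the permutation of the pair `(f, g)` is
that of the joint word `r ↦ (g r, f r)`. If the coproducts of the `a i` and `b j` are split
according to the positions of the pairs of letters, then the two tensors of `f` and `g` multiply
letter by letter to the tensors of the joint word with the labels `a_{i(j)} b_{j(i)}`. The content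
of the joint word is a matrix with row sums `c` and column sums `d`, and the joint words with a
given content add up to one of the external products on the right-hand side.
-/

noncomputable section

namespace FreeQSym

/-! ### Ordered products -/

section OrderedProducts

theorem prod_ofFn_eq_biUnion {α M : Type*} [DecidableEq α] [Mul M] [One M] (r : α → α → Prop)
    (F : Finset α → M) (empty : F ∅ = 1)
    (union : ∀ s t, (∀ x ∈ s, ∀ y ∈ t, r x y) → F s * F t = F (s ∪ t)) {n : ℕ}
    (B : Fin n → Finset α) (hB : ∀ i j, i < j → ∀ x ∈ B i, ∀ y ∈ B j, r x y) :
    (List.ofFn fun i => F (B i)).prod = F (Finset.univ.biUnion B) := by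
  induction n with
  | zero => simp [empty]
  | succ n ih =>
    have tail := ih (fun i => B i.succ) fun i j hij => hB _ _ (Fin.succ_lt_succ_iff.2 hij)
    rw [List.ofFn_succ, List.prod_cons, tail, union]
    · congr 1
      ext x
      simp [Fin.exists_fin_succ]
    · intro x hx y hy
      obtain ⟨i, -, hi⟩ := Finset.mem_biUnion.1 hy
      exact hB 0 i.succ (Fin.succ_pos i) x hx y hi

variable {α M : Type*} [Monoid M]

theorem prod_ofFn_noncommProd [DecidableEq α] (f : α → M)
    (comm : Pairwise fun x y => Commute (f x) (f y)) {n : ℕ} (B : Fin n → Finset α)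
    (hB : Pairwise fun i j => Disjoint (B i) (B j)) :
    (List.ofFn fun i => (B i).noncommProd f (comm.set_pairwise _)).prod =
      (Finset.univ.biUnion B).noncommProd f (comm.set_pairwise _) :=
  prod_ofFn_eq_biUnion (· ≠ ·) (fun s => s.noncommProd f (comm.set_pairwise _))
    (Finset.noncommProd_empty _ _)
    (fun _ _ h => (Finset.noncommProd_union_of_disjoint (Finset.disjoint_iff_ne.2 h) f _).symm) B
    fun _ _ hij => Finset.disjoint_iff_ne.1 (hB hij.ne)

variable [Fintype α]

theorem prod_map_eq_noncommProd_univ {l : List α} (nodup : l.Nodup) (mem : ∀ x, x ∈ l) (f : α → M)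
    (comm : Pairwise fun x y => Commute (f x) (f y)) :
    (l.map f).prod = Finset.univ.noncommProd f (comm.set_pairwise _) := by
  classical
  rw [← Finset.noncommProd_toFinset l f (comm.set_pairwise _) nodup]
  exact Finset.noncommProd_congr (by ext x; simp [mem]) (fun _ _ => rfl) _

theorem prod_ofFn_eq_noncommProd {n : ℕ} (f : Fin n → M)
    (comm : Pairwise fun i j => Commute (f i) (f j)) :
    (List.ofFn f).prod = Finset.univ.noncommProd f (comm.set_pairwise _) := by
  rw [List.ofFn_eq_map]
  exact prod_map_eq_noncommProd_univ (List.nodup_finRange n) List.mem_finRange f comm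

theorem prod_ofFn_prod_ofFn_eq_noncommProd {k l : ℕ} (e : Fin k × Fin l ≃ α) (f : α → M)
    (comm : Pairwise fun x y => Commute (f x) (f y)) :
    (List.ofFn fun i => (List.ofFn fun j => f (e (i, j))).prod).prod =
      Finset.univ.noncommProd f (comm.set_pairwise _) := by
  have nodup : ((List.finRange k ×ˢ List.finRange l).map e).Nodup :=
    ((List.nodup_finRange k).product (List.nodup_finRange l)).map e.injective
  rw [← prod_map_eq_noncommProd_univ nodup (fun x => List.mem_map.2
    ⟨e.symm x, List.mem_product.2 ⟨List.mem_finRange _, List.mem_finRange _⟩, e.apply_symm_apply x⟩)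
    f comm]
  simp [List.ofFn_eq_map, SProd.sprod, List.product, List.flatMap, List.prod_flatten,
    Function.comp_def]

theorem prod_ofFn_sum {R : Type*} [Semiring R] {n : ℕ}
    {m : Fin n → ℕ} (x : ∀ i, Fin (m i) → R) :
    (List.ofFn fun i => ∑ s, x i s).prod =
      ∑ s : (∀ i, Fin (m i)), (List.ofFn fun i => x i (s i)).prod := by
  simpa only [MultilinearMap.mkPiAlgebraFin_apply] using
    (MultilinearMap.mkPiAlgebraFin ℕ n R).map_sum x

end OrderedProducts

/-! ### Placing tensors at chosen positions -/

section Tensor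

variable {K A : Type*} [CommSemiring K] [Semiring A] [Algebra K A] {m n : ℕ}

/-- The element `1 ⊗ ⋯ ⊗ a ⊗ ⋯ ⊗ 1` of `A^{⊗ n}` with `a` at the position `p`, as a function
of `a`. -/
def place (p : Fin n) : A →ₐ[K] ⨂[K]^n A :=
  PiTensorProduct.singleAlgHom (A := fun _ => A) p

theorem place_apply (p : Fin n) (a : A) :
    place (K := K) p a = PiTensorProduct.tprod K (Pi.mulSingle p a : Fin n → A) :=
  rfl

theorem commute_place {p q : Fin n} (h : p ≠ q) (a b : A) :
    Commute (place (K := K) p a) (place q b) :=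
  (Pi.mulSingle_commute (f := fun _ : Fin n => A) h a b).tprod

theorem prod_ofFn_place (v : Fin n → A) :
    (List.ofFn fun p => place (K := K) p (v p)).prod = PiTensorProduct.tprod K v := by
  rw [prod_ofFn_eq_noncommProd _ fun p q h => commute_place h _ _]
  simp only [place_apply]
  rw [← PiTensorProduct.tprod_noncommProd _ _ fun p _ q _ h => Pi.mulSingle_commute h _ _,
    Finset.noncommProd_mulSingle]

theorem extend_update (e : Fin m ↪ Fin n) (v : Fin m → A) (i : Fin m) (x : A) :
    Function.extend e (Function.update v i x) 1 =
      Function.update (Function.extend e v 1) (e i) x := by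
  ext p
  by_cases h : ∃ j, e j = p
  · obtain ⟨j, rfl⟩ := h
    simp [e.injective.extend_apply, Function.update_apply]
  · rw [Function.extend_apply' _ _ _ h, Function.update_of_ne (fun hp => h ⟨i, hp.symm⟩),
      Function.extend_apply' _ _ _ h]

/-- The algebra map `A^{⊗ m} → A^{⊗ n}` which places the `i`-th factor at the position `e i` and
`1` at the positions outside the range of `e`. -/
def placeMap (e : Fin m ↪ Fin n) : ⨂[K]^m A →ₐ[K] ⨂[K]^n A :=
  PiTensorProduct.liftAlgHom
    { toFun v := PiTensorProduct.tprod K (Function.extend e v 1)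
      map_update_add' {inst} v i x y := by
        cases Subsingleton.elim inst (instDecidableEqFin m)
        simp only [extend_update, MultilinearMap.map_update_add]
      map_update_smul' {inst} v i c x := by
        cases Subsingleton.elim inst (instDecidableEqFin m)
        simp only [extend_update, MultilinearMap.map_update_smul] }
    (congrArg (PiTensorProduct.tprod K) (Function.extend_one e))
    fun v w => by
      have h := Function.extend_mul e v w 1 1
      rw [mul_one] at h
      exact (congrArg (PiTensorProduct.tprod K) h).trans
        (PiTensorProduct.tprod_mul_tprod _ _).symm

theorem placeMap_tprod (e : Fin m ↪ Fin n) (v : Fin m → A) :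
    placeMap e (PiTensorProduct.tprod K v) = PiTensorProduct.tprod K (Function.extend e v 1) :=
  PiTensorProduct.lift.tprod _

theorem placeMap_place (e : Fin m ↪ Fin n) (p : Fin m) (a : A) :
    placeMap e (place (K := K) p a) = place (e p) a := by
  have h : Function.extend e (1 : Fin m → A) 1 = 1 := Function.extend_one e
  rw [place_apply, placeMap_tprod, Pi.mulSingle, extend_update, h]
  rfl

theorem permTensor_eq_placeMap (π : Equiv.Perm (Fin n)) (t : ⨂[K]^n A) :
    permTensor π t = placeMap π.toEmbedding t := by
  suffices (permTensor π).toLinearMap = (placeMap (K := K) (A := A) π.toEmbedding).toLinearMap from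
    DFunLike.congr_fun this t
  ext v
  refine (permTensor_tprod π v).trans ((placeMap_tprod π.toEmbedding v).trans ?_).symm
  congr 1
  ext p
  obtain ⟨i, rfl⟩ := π.surjective p
  exact (π.injective.extend_apply v 1 i).trans (congrArg v (π.symm_apply_apply i).symm)

theorem castAdd_lt_natAdd (i : Fin m) (j : Fin n) : Fin.castAdd n i < Fin.natAdd m j :=
  Fin.lt_def.2 (i.isLt.trans_le (Nat.le_add_right m j))

theorem append_eq_extend_mul_extend (v : Fin m → A) (w : Fin n → A) :
    Fin.append v w =
      Function.extend (Fin.castAddEmb n) v 1 * Function.extend (Fin.natAddEmb m) w 1 := by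
  have left (i : Fin m) : ¬∃ j, Fin.natAddEmb m j = Fin.castAdd n i :=
    fun ⟨j, hj⟩ => (castAdd_lt_natAdd i j).ne' hj
  have right (i : Fin n) : ¬∃ j, Fin.castAddEmb n j = Fin.natAdd m i :=
    fun ⟨j, hj⟩ => (castAdd_lt_natAdd j i).ne hj
  ext p
  induction p using Fin.addCases with
  | left i =>
    have := (Fin.castAddEmb (m := n)).injective.extend_apply v 1 i
    rw [Fin.append_left, Pi.mul_apply, Function.extend_apply' _ _ _ (left i)]
    simpa using this.symm
  | right i =>
    have := (Fin.natAddEmb m).injective.extend_apply w 1 i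
    rw [Fin.append_right, Pi.mul_apply, Function.extend_apply' _ _ _ (right i)]
    simpa using this.symm

theorem concat_eq_placeMap_mul_placeMap (t : ⨂[K]^m A) (u : ⨂[K]^n A) :
    concat t u = placeMap (Fin.castAddEmb n) t * placeMap (Fin.natAddEmb m) u := by
  suffices TensorPower.mulEquiv.toLinearMap = LinearMap.mul' K (⨂[K]^(m + n) A) ∘ₗ
      TensorProduct.map (placeMap (Fin.castAddEmb n)).toLinearMap
        (placeMap (Fin.natAddEmb m)).toLinearMap from
    DFunLike.congr_fun this (t ⊗ₜ u)
  ext v w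
  refine (concat_tprod v w).trans ?_
  rw [append_eq_extend_mul_extend, ← PiTensorProduct.tprod_mul_tprod, ← placeMap_tprod,
    ← placeMap_tprod]
  rfl

end Tensor

/-! ### Convolution products and iterated coproducts -/

section Convolution

open WithConv

variable {K V R : Type*} [CommSemiring K] [AddCommMonoid V] [Module K V]
  [Semiring R] [Algebra K R]

/-- The linear map `v_1 ⊗ ⋯ ⊗ v_n ↦ φ_1(v_1) ⋯ φ_n(v_n)`, through which convolution products
factor. -/
def prodLift {n : ℕ} (φ : Fin n → WithConv (V →ₗ[K] R)) : ⨂[K]^n V →ₗ[K] R :=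
  PiTensorProduct.lift
    ((MultilinearMap.mkPiAlgebraFin K n R).compLinearMap fun i => (φ i).ofConv)

theorem prodLift_tprod {n : ℕ} (φ : Fin n → WithConv (V →ₗ[K] R)) (v : Fin n → V) :
    prodLift φ (PiTensorProduct.tprod K v) = (List.ofFn fun i => φ i (v i)).prod :=
  PiTensorProduct.lift.tprod _

theorem prodLift_concat {m n : ℕ} (φ : Fin (m + n) → WithConv (V →ₗ[K] R))
    (t : ⨂[K]^m V) (u : ⨂[K]^n V) :
    prodLift φ (concat t u) =
      prodLift (fun i => φ (Fin.castAdd n i)) t * prodLift (fun i => φ (Fin.natAdd m i)) u := by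
  suffices prodLift φ ∘ₗ TensorPower.mulEquiv.toLinearMap = LinearMap.mul' K R ∘ₗ
      TensorProduct.map (prodLift fun i => φ (Fin.castAdd n i))
        (prodLift fun i => φ (Fin.natAdd m i)) from
    DFunLike.congr_fun this (t ⊗ₜ u)
  ext v w
  suffices prodLift φ (concat (PiTensorProduct.tprod K v) (PiTensorProduct.tprod K w)) =
      prodLift (fun i => φ (Fin.castAdd n i)) (PiTensorProduct.tprod K v) *
        prodLift (fun i => φ (Fin.natAdd m i)) (PiTensorProduct.tprod K w) from this
  rw [concat_tprod, prodLift_tprod, prodLift_tprod, prodLift_tprod, ← List.prod_append,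
    ← List.ofFn_fin_append]
  congr 2
  ext i
  induction i using Fin.addCases <;> simp

variable [Coalgebra K V]

theorem iterComul_zero (v : V) :
    iterComul K 0 v = Coalgebra.counit (R := K) v • PiTensorProduct.tprod K Fin.elim0 :=
  TensorPower.algebraMap₀_eq_smul_one _

theorem iterComul_succ {n : ℕ} {ι : Type*} {v : V} (r : Coalgebra.Repr K v ι) :
    iterComul K (n + 1) v = ∑ i ∈ r.index,
      concat (iterComul K n (r.left i)) (PiTensorProduct.tprod K fun _ : Fin 1 => r.right i) := by
  simp only [iterComul, LinearMap.comp_apply, ← r.eq, map_sum, TensorProduct.map_tmul,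
    LinearEquiv.coe_coe, PiTensorProduct.subsingletonEquiv_symm_apply']
  rfl

theorem convProd_apply {n : ℕ} (φ : Fin n → WithConv (V →ₗ[K] R)) (v : V) :
    (List.ofFn φ).prod v = prodLift φ (iterComul K n v) := by
  induction n generalizing v with
  | zero => simp [iterComul_zero, prodLift_tprod, Algebra.algebraMap_eq_smul_one]
  | succ n ih =>
    let r := Coalgebra.Repr.arbitrary K v
    rw [List.ofFn_succ', List.concat_eq_append, List.prod_append, List.prod_singleton,
      r.convMul_apply, iterComul_succ r, map_sum]
    refine Finset.sum_congr rfl fun i _ => ?_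
    rw [ih, prodLift_concat, prodLift_tprod, List.ofFn_succ, List.ofFn_zero, List.prod_singleton]
    rfl

theorem commute_conv [Coalgebra.IsCocomm K V] {f g : WithConv (V →ₗ[K] R)}
    (h : ∀ v w, Commute (f v) (g w)) : Commute f g := by
  ext v
  have swap : LinearMap.mul' K R ∘ₗ TensorProduct.map f.ofConv g.ofConv =
      LinearMap.mul' K R ∘ₗ TensorProduct.map g.ofConv f.ofConv ∘ₗ
        (TensorProduct.comm K V V).toLinearMap := by
    ext v w
    simpa using (h v w).eq
  simpa [Coalgebra.comm_comul] using DFunLike.congr_fun swap (Coalgebra.comul (R := K) v)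

end Convolution

/-! ### Iterated coproducts placed at a set of positions -/

section Spread

open WithConv

section Coalgebra

variable {K A : Type*} [CommSemiring K] [Semiring A] [Algebra K A] [Coalgebra K A]
  [Coalgebra.IsCocomm K A] {m n : ℕ}

theorem pairwise_commute_place :
    Pairwise fun p q : Fin n =>
      Commute (toConv (place (K := K) (A := A) p).toLinearMap) (toConv (place q).toLinearMap) :=
  fun _ _ h => commute_conv fun a b => commute_place h a b

variable (K) in
/-- The element of `A^{⊗ n}` with the factors of the iterated coproduct of `a` at the positions
in `S`, and `1` at the other positions, as a function of `a`. It is the convolution product of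
the maps `place p` for `p ∈ S`, whose order does not matter since `A` is cocommutative. -/
def spread (S : Finset (Fin n)) : WithConv (A →ₗ[K] ⨂[K]^n A) :=
  S.noncommProd (fun p => toConv (place p).toLinearMap) (pairwise_commute_place.set_pairwise _)

theorem spread_empty_apply (a : A) :
    spread K (∅ : Finset (Fin n)) a = algebraMap K _ (Coalgebra.counit (R := K) a) := by
  rw [spread, Finset.noncommProd_empty, LinearMap.convOne_apply]

theorem spread_insert {p : Fin n} {S : Finset (Fin n)} (h : p ∉ S) :
    spread K (A := A) (insert p S) = toConv (place p).toLinearMap * spread K S :=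
  Finset.noncommProd_insert_of_notMem _ _ _ _ h

theorem spread_insert_apply {p : Fin n} {S : Finset (Fin n)} (h : p ∉ S) {a : A}
    {ι : Type*} (r : Coalgebra.Repr K a ι) :
    spread K (insert p S) a = ∑ i ∈ r.index, place p (r.left i) * spread K S (r.right i) := by
  rw [spread_insert h, r.convMul_apply]
  rfl

theorem commute_spread_of_commute_place {x : ⨂[K]^n A} {S : Finset (Fin n)}
    (h : ∀ p ∈ S, ∀ a, Commute x (place p a)) (a : A) : Commute x (spread K S a) := by
  induction S using Finset.induction_on generalizing a with
  | empty => exact spread_empty_apply (K := K) a ▸ (Algebra.commutes _ x).symm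
  | insert p S hp ih =>
    rw [spread_insert_apply hp (Coalgebra.Repr.arbitrary K a)]
    exact Commute.sum_right _ _ _ fun i _ => (h p (Finset.mem_insert_self p S) _).mul_right
      (ih (fun q hq => h q (Finset.mem_insert_of_mem hq)) _)

theorem commute_place_spread {p : Fin n} {S : Finset (Fin n)} (h : p ∉ S) (a b : A) :
    Commute (place p a) (spread K S b) :=
  commute_spread_of_commute_place
    (fun _ hq c => commute_place (ne_of_mem_of_not_mem hq h).symm a c) b

theorem commute_spread {S T : Finset (Fin n)} (h : Disjoint S T) (a b : A) :
    Commute (spread K S a) (spread K T b) :=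
  commute_spread_of_commute_place
    (fun _ hq c => (commute_place_spread (Finset.disjoint_right.1 h hq) c a).symm) b

theorem placeMap_spread (e : Fin m ↪ Fin n) (S : Finset (Fin m)) (a : A) :
    placeMap e (spread K S a) = spread K (S.map e) a := by
  induction S using Finset.induction_on generalizing a with
  | empty => rw [Finset.map_empty, spread_empty_apply, spread_empty_apply, AlgHom.commutes]
  | insert p S hp ih =>
    let r := Coalgebra.Repr.arbitrary K a
    rw [Finset.map_insert, spread_insert_apply hp r, spread_insert_apply (by simpa using hp) r,
      map_sum]
    exact Finset.sum_congr rfl fun i _ => by rw [map_mul, placeMap_place, ih]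

theorem prod_ofFn_spread {l : ℕ} (B : Fin l → Finset (Fin n))
    (hB : Pairwise fun i j => Disjoint (B i) (B j)) :
    (List.ofFn fun j => spread K (A := A) (B j)).prod = spread K (Finset.univ.biUnion B) :=
  prod_ofFn_noncommProd _ pairwise_commute_place B hB

theorem spread_univ (a : A) : spread K (Finset.univ : Finset (Fin n)) a = iterComul K n a := by
  have lift_place : prodLift (fun p : Fin n => toConv (place (K := K) (A := A) p).toLinearMap) =
      LinearMap.id := by
    ext v
    exact (prodLift_tprod _ v).trans (prod_ofFn_place v)
  rw [spread, ← prod_ofFn_eq_noncommProd _ pairwise_commute_place, convProd_apply, lift_place,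
    LinearMap.id_apply]

theorem spread_eq_sum {l : ℕ} (S : Finset (Fin n)) (g : Fin n → Fin l) {a : A}
    (p : Sweedler K l a) :
    spread K S a = ∑ s, (List.ofFn fun j => spread K {i ∈ S | g i = j} (p.term s j)).prod := by
  have disjoint : Pairwise fun j j' => Disjoint {i ∈ S | g i = j} {i ∈ S | g i = j'} :=
    fun j j' h => Finset.disjoint_filter.2 fun i _ hj hj' => h (hj.symm.trans hj')
  have split : S = Finset.univ.biUnion fun j => {i ∈ S | g i = j} := by
    ext i
    simp
  conv_lhs => rw [split]
  rw [← prod_ofFn_spread _ disjoint, convProd_apply, p.eq, map_sum]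
  simp only [prodLift_tprod]

end Coalgebra

theorem spread_mul {K A : Type*} [CommSemiring K] [Semiring A] [Bialgebra K A]
    [Coalgebra.IsCocomm K A] {n : ℕ} (S : Finset (Fin n)) (a b : A) :
    spread K S (a * b) = spread K S a * spread K S b := by
  induction S using Finset.induction_on generalizing a b with
  | empty => simp only [spread_empty_apply, Bialgebra.counit_mul, map_mul]
  | insert p S hp ih =>
    let r := Coalgebra.Repr.arbitrary K a
    let r' := Coalgebra.Repr.arbitrary K b
    have comul_mul : spread K (insert p S) (a * b) = ∑ i ∈ r.index, ∑ j ∈ r'.index,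
        place p (r.left i * r'.left j) * spread K S (r.right i * r'.right j) := by
      rw [spread_insert hp, LinearMap.convMul_apply, Bialgebra.comul_mul, ← r.eq, ← r'.eq]
      simp only [Finset.sum_mul_sum, Algebra.TensorProduct.tmul_mul_tmul, map_sum,
        TensorProduct.map_tmul, LinearMap.mul'_apply]
      rfl
    rw [comul_mul, spread_insert_apply hp r, spread_insert_apply hp r', Finset.sum_mul_sum]
    refine Finset.sum_congr rfl fun i _ => Finset.sum_congr rfl fun j _ => ?_
    rw [map_mul, ih, (commute_place_spread hp _ _).mul_mul_mul_comm]

end Spread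

/-! ### Words -/

section Words

variable {Λ : Type*} [DecidableEq Λ] {m n : ℕ}

/-- The set of the positions of the letter `x` in the word `f`. -/
def fiber (f : Fin n → Λ) (x : Λ) : Finset (Fin n) :=
  {i | f i = x}

theorem mem_fiber {f : Fin n → Λ} {x : Λ} {i : Fin n} : i ∈ fiber f x ↔ f i = x := by
  simp [fiber]

theorem disjoint_fiber (f : Fin n → Λ) {x y : Λ} (h : x ≠ y) :
    Disjoint (fiber f x) (fiber f y) :=
  Finset.disjoint_filter.2 fun _ _ hx hy => h (hx.symm.trans hy)

theorem map_fiber_perm (σ : Equiv.Perm (Fin n)) (f : Fin n → Λ) (x : Λ) :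
    (fiber f x).map σ.toEmbedding = fiber (f ∘ ⇑σ⁻¹) x := by
  ext i
  simp [mem_fiber, Finset.mem_map_equiv]

theorem map_castAddEmb_fiber (f : Fin m → Λ) {g : Fin n → Λ} {x : Λ} (hg : ∀ i, g i ≠ x) :
    (fiber f x).map (Fin.castAddEmb n) = fiber (Fin.append f g) x := by
  ext i
  induction i using Fin.addCases with
  | left i => simp [mem_fiber]
  | right i => simp [mem_fiber, hg, (castAdd_lt_natAdd _ i).ne]

theorem map_natAddEmb_fiber {f : Fin m → Λ} (g : Fin n → Λ) {x : Λ} (hf : ∀ i, f i ≠ x) :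
    (fiber g x).map (Fin.natAddEmb m) = fiber (Fin.append f g) x := by
  ext i
  induction i using Fin.addCases with
  | left i => simp [mem_fiber, hf, (castAdd_lt_natAdd i _).ne']
  | right i => simp [mem_fiber]

/-- The set of the words of length `n` over the alphabet `B` in which each letter `x ∈ B` occurs
`c x` times. -/
def words (n : ℕ) (B : Finset Λ) (c : Λ → ℕ) : Finset (Fin n → Λ) :=
  {f ∈ Fintype.piFinset fun _ => B | ∀ x ∈ B, (fiber f x).card = c x}

variable {B C : Finset Λ} {c : Λ → ℕ}

theorem mem_words {f : Fin n → Λ} :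
    f ∈ words n B c ↔ (∀ i, f i ∈ B) ∧ ∀ x ∈ B, (fiber f x).card = c x := by
  simp [words]

theorem comp_mem_words {f : Fin n → Λ} (σ : Equiv.Perm (Fin n)) :
    f ∘ σ ∈ words n B c ↔ f ∈ words n B c := by
  have card_fiber (x : Λ) : (fiber (f ∘ σ) x).card = (fiber f x).card := by
    have := map_fiber_perm σ⁻¹ f x
    rw [inv_inv] at this
    rw [← this, Finset.card_map]
  simp only [mem_words, card_fiber, Function.comp_apply]
  rw [σ.forall_congr_right (q := fun i => f i ∈ B)]

theorem append_mem_words_iff (h : Disjoint B C) {f : Fin m → Λ} {g : Fin n → Λ}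
    (hf : ∀ i, f i ∈ B) (hg : ∀ i, g i ∈ C) :
    Fin.append f g ∈ words (m + n) (B ∪ C) c ↔ f ∈ words m B c ∧ g ∈ words n C c := by
  have left {x : Λ} (hx : x ∈ B) : (fiber (Fin.append f g) x).card = (fiber f x).card := by
    rw [← map_castAddEmb_fiber f fun i (hi : g i = x) =>
      Finset.disjoint_left.1 h hx (hi ▸ hg i), Finset.card_map]
  have right {x : Λ} (hx : x ∈ C) : (fiber (Fin.append f g) x).card = (fiber g x).card := by
    rw [← map_natAddEmb_fiber g fun i (hi : f i = x) =>
      Finset.disjoint_left.1 h (hi ▸ hf i) hx, Finset.card_map]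
  have mem (i : Fin (m + n)) : Fin.append f g i ∈ B ∪ C := by
    induction i using Fin.addCases <;> simp [hf, hg]
  simp +contextual only [mem_words, Finset.forall_mem_union, left, right, mem, hf, hg,
    implies_true, true_and]

theorem card_filter_mem_of_mem_words {D : Finset Λ} (hD : D ⊆ B) {f : Fin n → Λ}
    (hf : f ∈ words n B c) : (Finset.univ.filter fun i => f i ∈ D).card = ∑ x ∈ D, c x := by
  rw [Finset.card_eq_sum_card_fiberwise (f := f) (t := D) (by intro i; simp)]
  refine Finset.sum_congr rfl fun x hx => ?_
  rw [← (mem_words.1 hf).2 x (hD hx), fiber, Finset.filter_filter]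
  congr 1
  ext i
  simp +contextual [hx]

theorem words_empty : words 0 (∅ : Finset Λ) c = {Fin.elim0} := by
  ext f
  simp [mem_words, Subsingleton.elim f Fin.elim0]

theorem words_singleton (x : Λ) : words (c x) {x} c = {fun _ => x} := by
  ext f
  simp only [mem_words, Finset.mem_singleton, forall_eq, ← funext_iff (f := f)]
  constructor
  · exact And.left
  · rintro rfl
    simp [fiber]

end Words

/-! ### The tensor of a word -/

section WordTensor

section Coalgebra

variable {K A Λ : Type*} [CommSemiring K] [Semiring A] [Algebra K A] [Coalgebra K A]
  [Coalgebra.IsCocomm K A] [DecidableEq Λ] {m n : ℕ}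

theorem commute_spread_fiber (f : Fin n → Λ) (a b : Λ → A) :
    Pairwise fun x y => Commute (spread K (fiber f x) (a x)) (spread K (fiber f y) (b y)) :=
  fun _ _ h => commute_spread (disjoint_fiber f h) _ _

variable (K) in
/-- The tensor with the factors of the iterated coproduct of `a x` at the positions of the letter
`x` in the word `f`, for all letters `x ∈ B`. -/
def wordTensor (B : Finset Λ) (a : Λ → A) (f : Fin n → Λ) : ⨂[K]^n A :=
  B.noncommProd (fun x => spread K (fiber f x) (a x))
    ((commute_spread_fiber f a a).set_pairwise _)

theorem placeMap_wordTensor (e : Fin m ↪ Fin n) {B : Finset Λ} (a : Λ → A) {f : Fin m → Λ}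
    {g : Fin n → Λ} (h : ∀ x ∈ B, (fiber f x).map e = fiber g x) :
    placeMap e (wordTensor K B a f) = wordTensor K B a g := by
  rw [wordTensor, Finset.map_noncommProd]
  exact Finset.noncommProd_congr rfl (fun x hx => by rw [placeMap_spread, h x hx]) _

theorem permTensor_wordTensor (π : Equiv.Perm (Fin n)) (B : Finset Λ) (a : Λ → A)
    (f : Fin n → Λ) :
    permTensor π (wordTensor K B a f) = wordTensor K B a (f ∘ ⇑π⁻¹) := by
  rw [permTensor_eq_placeMap]
  exact placeMap_wordTensor _ a fun x _ => map_fiber_perm π f x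

theorem concat_wordTensor {B C : Finset Λ} (h : Disjoint B C) (a : Λ → A) {f : Fin m → Λ}
    {g : Fin n → Λ} (hf : ∀ i, f i ∈ B) (hg : ∀ i, g i ∈ C) :
    concat (wordTensor K B a f) (wordTensor K C a g) =
      wordTensor K (B ∪ C) a (Fin.append f g) := by
  have left : ∀ x ∈ B, (fiber f x).map (Fin.castAddEmb n) = fiber (Fin.append f g) x :=
    fun x hx => map_castAddEmb_fiber f fun i hi => Finset.disjoint_left.1 h hx (hi ▸ hg i)
  have right : ∀ x ∈ C, (fiber g x).map (Fin.natAddEmb m) = fiber (Fin.append f g) x :=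
    fun x hx => map_natAddEmb_fiber g fun i hi => Finset.disjoint_left.1 h (hi ▸ hf i) hx
  rw [concat_eq_placeMap_mul_placeMap, placeMap_wordTensor _ a left, placeMap_wordTensor _ a right]
  exact (Finset.noncommProd_union_of_disjoint h _ _).symm

theorem wordTensor_eq_sum {k l : ℕ} [Fintype Λ] (e : Fin k × Fin l ≃ Λ) {a : Fin k → A}
    (p : ∀ i, Sweedler K l (a i)) (f : Fin n → Fin k) (g : Fin n → Fin l) :
    wordTensor K Finset.univ a f = ∑ s : (∀ i, Fin (p i).size),
      wordTensor K Finset.univ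
        (fun x => (p (e.symm x).1).term (s (e.symm x).1) (e.symm x).2) fun r => e (f r, g r) := by
  have filter_fiber (i : Fin k) (j : Fin l) :
      {r ∈ fiber f i | g r = j} = fiber (fun r => e (f r, g r)) (e (i, j)) := by
    ext r
    simp [mem_fiber]
  rw [wordTensor, ← prod_ofFn_eq_noncommProd _ (commute_spread_fiber f a a)]
  simp only [fun i => spread_eq_sum (fiber f i) g (p i), filter_fiber]
  rw [prod_ofFn_sum]
  refine Finset.sum_congr rfl fun s _ => ?_
  rw [wordTensor, ← prod_ofFn_prod_ofFn_eq_noncommProd e _ (commute_spread_fiber _ _ _)]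
  have label (i : Fin k) (j : Fin l) := congrArg
    (fun z : Fin k × Fin l => (p z.1).term (s z.1) z.2) (e.symm_apply_apply (i, j))
  simp only [label]

end Coalgebra

theorem wordTensor_mul {K A Λ : Type*} [CommSemiring K] [Semiring A] [Bialgebra K A]
    [Coalgebra.IsCocomm K A] [DecidableEq Λ] {n : ℕ} (B : Finset Λ) (a b : Λ → A)
    (f : Fin n → Λ) :
    wordTensor K B (a * b) f = wordTensor K B a f * wordTensor K B b f := by
  rw [wordTensor, wordTensor, wordTensor,
    ← Finset.noncommProd_mul_distrib _ _ _ _ ((commute_spread_fiber f b a).set_pairwise _)]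
  exact Finset.noncommProd_congr rfl (fun x _ => spread_mul _ _ _) _

end WordTensor

/-! ### Stable sorting -/

section Sorting

variable {α β : Type*} [LinearOrder α] [LinearOrder β] {m n : ℕ}

theorem eq_sort_iff_strictMono {f : Fin n → α} {σ : Equiv.Perm (Fin n)} :
    σ = Tuple.sort f ↔ StrictMono fun i => toLex (f (σ i), σ i) :=
  Tuple.eq_sort_iff'

theorem strictMono_sort (f : Fin n → α) :
    StrictMono fun i => toLex (f (Tuple.sort f i), Tuple.sort f i) :=
  eq_sort_iff_strictMono.1 rfl

theorem sort_mul_sort (f : Fin n → α) (g : Fin n → β) :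
    Tuple.sort f * Tuple.sort (g ∘ Tuple.sort f) = Tuple.sort fun i => toLex (g i, f i) := by
  refine eq_sort_iff_strictMono.2 fun i j hij => ?_
  have hg := strictMono_sort (g ∘ Tuple.sort f) hij
  have hf {i j} (h : i < j) := strictMono_sort f h
  simp only [Prod.Lex.toLex_lt_toLex, Function.comp_apply] at hf hg
  simp only [Prod.Lex.toLex_lt_toLex, Equiv.Perm.mul_apply, EmbeddingLike.apply_eq_iff_eq,
    Prod.mk.injEq]
  grind

theorem strictMono_fin_add_iff {γ : Type*} [Preorder γ] {h : Fin (m + n) → γ} :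
    StrictMono h ↔
      (StrictMono fun i => h (Fin.castAdd n i)) ∧ (StrictMono fun j => h (Fin.natAdd m j)) ∧
        ∀ i j, h (Fin.castAdd n i) < h (Fin.natAdd m j) := by
  refine ⟨fun H => ⟨fun i j hij => H hij, fun i j hij => H (by simpa using hij),
    fun i j => H (castAdd_lt_natAdd i j)⟩, fun ⟨left, right, cross⟩ i j hij => ?_⟩
  induction i using Fin.addCases with
  | left i =>
    induction j using Fin.addCases with
    | left j => exact left hij
    | right j => exact cross i j
  | right i =>
    induction j using Fin.addCases with
    | left j => exact absurd hij (castAdd_lt_natAdd j i).not_gt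
    | right j => exact right (by simpa using hij)

theorem permProd_castAdd (σ : Equiv.Perm (Fin m)) (σ' : Equiv.Perm (Fin n))
    (i : Fin m) : permProd σ σ' (Fin.castAdd n i) = Fin.castAdd n (σ i) := by
  simp [permProd, Equiv.permCongr_apply]

theorem permProd_natAdd (σ : Equiv.Perm (Fin m)) (σ' : Equiv.Perm (Fin n))
    (i : Fin n) : permProd σ σ' (Fin.natAdd m i) = Fin.natAdd m (σ' i) := by
  simp [permProd, Equiv.permCongr_apply]

theorem mem_shuffles {ρ : Equiv.Perm (Fin (m + n))} :
    ρ ∈ shuffles m n ↔ StrictMono (fun i : Fin m => ρ (Fin.castAdd n i)) ∧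
      StrictMono (fun j : Fin n => ρ (Fin.natAdd m j)) := by
  simp [shuffles]

theorem shuffle_mul_permProd_sort {ρ : Equiv.Perm (Fin (m + n))} (hρ : ρ ∈ shuffles m n)
    {f : Fin m → α} {g : Fin n → α} (h : ∀ i j, f i < g j) :
    ρ * permProd (Tuple.sort f) (Tuple.sort g) = Tuple.sort (Fin.append f g ∘ ⇑ρ⁻¹) := by
  obtain ⟨left, right⟩ := mem_shuffles.1 hρ
  refine eq_sort_iff_strictMono.2 (strictMono_fin_add_iff.2 ⟨fun i j hij => ?_, fun i j hij => ?_,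
    fun i j => ?_⟩)
  · simpa [permProd_castAdd, Prod.Lex.toLex_lt_toLex, left.lt_iff_lt] using strictMono_sort f hij
  · simpa [permProd_natAdd, Prod.Lex.toLex_lt_toLex, right.lt_iff_lt] using strictMono_sort g hij
  · simp [permProd_castAdd, permProd_natAdd, Prod.Lex.toLex_lt_toLex, h]

theorem sort_append_const_comp_shuffle {ρ : Equiv.Perm (Fin (m + n))} (hρ : ρ ∈ shuffles m n) :
    Tuple.sort (Fin.append (fun _ => false) (fun _ => true) ∘ ⇑ρ⁻¹) = ρ := by
  rw [← shuffle_mul_permProd_sort hρ (by simp), Tuple.sort_eq_refl_iff_monotone.2 monotone_const,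
    Tuple.sort_eq_refl_iff_monotone.2 monotone_const]
  ext i
  induction i using Fin.addCases <;> simp [permProd_castAdd, permProd_natAdd]

theorem exists_mem_shuffles {p : Fin (m + n) → Prop} [DecidablePred p]
    (hp : (Finset.univ.filter p).card = m) : ∃ ρ ∈ shuffles m n,
      (∀ i, p (ρ (Fin.castAdd n i))) ∧ ∀ j, ¬p (ρ (Fin.natAdd m j)) := by
  obtain ⟨f, hf⟩ : ∃ f : Fin (m + n) → Bool, ∀ i, f i = false ↔ p i :=
    ⟨fun i => !decide (p i), by simp⟩
  have card : (Finset.univ.filter fun i => f (Tuple.sort f i) = false).card = m :=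
    (Finset.card_equiv (Tuple.sort f) (by simp [hf])).trans hp
  have sorted_false_iff (i : Fin (m + n)) : f (Tuple.sort f i) = false ↔ (i : ℕ) < m := by
    have le_false (x : Bool) : x ≤ false ↔ x = false := le_bot_iff
    simpa only [le_false, card, Function.comp_apply] using
      (Tuple.lt_card_le_iff_apply_le_of_monotone (j := i) (a := false)
        (Tuple.monotone_sort f)).symm
  have left (i : Fin m) : f (Tuple.sort f (Fin.castAdd n i)) = false := by
    simp [sorted_false_iff]
  have right (j : Fin n) : f (Tuple.sort f (Fin.natAdd m j)) = true := by
    simp [← Bool.not_eq_false, sorted_false_iff]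
  refine ⟨Tuple.sort f, mem_shuffles.2 ⟨fun i j hij => ?_, fun i j hij => ?_⟩,
    fun i => (hf _).1 (left i), fun j => by simp [← hf, right]⟩
  · simpa [Prod.Lex.toLex_lt_toLex, left] using strictMono_sort f (Fin.strictMono_castAdd n hij)
  · simpa [Prod.Lex.toLex_lt_toLex, right] using strictMono_sort f (Fin.strictMono_natAdd m hij)

end Sorting

/-! ### Merging words along shuffles -/

section MergeWords

variable {Λ : Type*} {m n : ℕ}

/-- The word whose subword at the positions `ρ (castAdd n i)` is `f` and whose subword at the
positions `ρ (natAdd m j)` is `g`, for a triple `z = ((f, g), ρ)`. -/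
def mergeWords (z : ((Fin m → Λ) × (Fin n → Λ)) × Equiv.Perm (Fin (m + n))) :
    Fin (m + n) → Λ :=
  Fin.append z.1.1 z.1.2 ∘ ⇑z.2⁻¹

variable [DecidableEq Λ] {B C : Finset Λ} {c : Λ → ℕ}

theorem sort_mem_mergeWords (h : Disjoint B C) {f : Fin m → Λ} {g : Fin n → Λ}
    {ρ : Equiv.Perm (Fin (m + n))} (hf : ∀ i, f i ∈ B) (hg : ∀ i, g i ∈ C)
    (hρ : ρ ∈ shuffles m n) :
    Tuple.sort (fun i => decide (mergeWords ((f, g), ρ) i ∈ C)) = ρ := by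
  refine Eq.trans ?_ (sort_append_const_comp_shuffle hρ)
  congr 1
  ext i
  obtain ⟨i, rfl⟩ := ρ.surjective i
  have hf' (i : Fin m) : f i ∉ C := Finset.disjoint_left.1 h (hf i)
  induction i using Fin.addCases <;> simp [mergeWords, hf', hg]

theorem injOn_mergeWords (h : Disjoint B C) :
    Set.InjOn (mergeWords (Λ := Λ) (m := m) (n := n))
      ↑((words m B c ×ˢ words n C c) ×ˢ shuffles m n) := by
  rintro ⟨⟨f, g⟩, ρ⟩ hz ⟨⟨f', g'⟩, ρ'⟩ hz' heq
  simp only [Finset.coe_product, Set.mem_prod, Finset.mem_coe, mem_words] at hz hz'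
  have hρ : ρ = ρ' := by
    rw [← sort_mem_mergeWords h hz.1.1.1 hz.1.2.1 hz.2, heq,
      sort_mem_mergeWords h hz'.1.1.1 hz'.1.2.1 hz'.2]
  subst hρ
  have happ : Fin.append f g = Fin.append f' g' := ρ⁻¹.surjective.injective_comp_right heq
  have hf : f = f' := funext fun i => by simpa using congrFun happ (Fin.castAdd n i)
  have hg : g = g' := funext fun j => by simpa using congrFun happ (Fin.natAdd m j)
  rw [hf, hg]

theorem mapsTo_mergeWords (h : Disjoint B C) :
    Set.MapsTo (mergeWords (Λ := Λ) (m := m) (n := n))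
      ↑((words m B c ×ˢ words n C c) ×ˢ shuffles m n) ↑(words (m + n) (B ∪ C) c) := by
  rintro ⟨⟨f, g⟩, ρ⟩ hz
  simp only [Finset.coe_product, Set.mem_prod, Finset.mem_coe] at hz
  exact (comp_mem_words ρ⁻¹).2
    ((append_mem_words_iff h (mem_words.1 hz.1.1).1 (mem_words.1 hz.1.2).1).2 hz.1)

theorem surjOn_mergeWords (h : Disjoint B C) (hm : ∑ x ∈ B, c x = m) :
    Set.SurjOn (mergeWords (Λ := Λ) (m := m) (n := n))
      ↑((words m B c ×ˢ words n C c) ×ˢ shuffles m n) ↑(words (m + n) (B ∪ C) c) := by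
  intro w hw
  obtain ⟨ρ, hρ, hB, hC⟩ := exists_mem_shuffles
    ((card_filter_mem_of_mem_words Finset.subset_union_left hw).trans hm)
  replace hC (j : Fin n) : w (ρ (Fin.natAdd m j)) ∈ C :=
    (Finset.mem_union.1 ((mem_words.1 hw).1 _)).resolve_left (hC j)
  have append_eq : Fin.append (fun i => w (ρ (Fin.castAdd n i)))
      (fun j => w (ρ (Fin.natAdd m j))) = w ∘ ρ := Fin.append_castAdd_natAdd (f := w ∘ ρ)
  refine ⟨((fun i => w (ρ (Fin.castAdd n i)), fun j => w (ρ (Fin.natAdd m j))), ρ), ?_, ?_⟩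
  · simp only [Finset.coe_product, Set.mem_prod, Finset.mem_coe]
    refine ⟨(append_mem_words_iff h hB hC).1 ?_, hρ⟩
    rw [append_eq]
    exact (comp_mem_words ρ).2 hw
  · ext i
    simp [mergeWords, append_eq]

end MergeWords

/-! ### External products of the elements `y_{n,v}` -/

theorem map_sum_sum {ι κ M N P : Type*} [AddCommMonoid M] [AddCommMonoid N] [AddCommMonoid P]
    (F : M →+ N →+ P) (s : Finset ι) (t : Finset κ) (α : ι → M) (β : κ → N) :
    F (∑ i ∈ s, α i) (∑ j ∈ t, β j) = ∑ i ∈ s, ∑ j ∈ t, F (α i) (β j) := by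
  rw [map_sum F, AddMonoidHom.finsetSum_apply]
  simp only [map_sum]

theorem extProd_sum {ι κ K V : Type*} [CommSemiring K] [AddCommMonoid V] [Module K V] {m n : ℕ}
    (s : Finset ι) (t : Finset κ) (α : ι → Comp K V m) (β : κ → Comp K V n) :
    extProd (∑ i ∈ s, α i) (∑ j ∈ t, β j) = ∑ i ∈ s, ∑ j ∈ t, extProd (α i) (β j) :=
  map_sum_sum (DirectSum.gMulHom fun n => Comp K V n) s t α β

section WordSum

variable {K A Λ : Type*} [CommSemiring K] [Semiring A] [Algebra K A] [Coalgebra K A]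
  [Coalgebra.IsCocomm K A] [LinearOrder Λ] {m n : ℕ}

variable (K) in
/-- The sum of the elements `t_f # σ_f` over the words `f` of length `n` with content `c` on the
alphabet `B`, where `t_f` is the tensor of `f` and `σ_f` is its stable sorting permutation. -/
def wordComp (n : ℕ) (B : Finset Λ) (c : Λ → ℕ) (a : Λ → A) : Comp K A n :=
  ∑ f ∈ words n B c, sharp (Tuple.sort f) (wordTensor K B a f)

theorem extProd_wordComp {B C : Finset Λ} (h : ∀ x ∈ B, ∀ z ∈ C, x < z) {c : Λ → ℕ} (a : Λ → A)
    (hm : ∑ x ∈ B, c x = m) :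
    extProd (wordComp K m B c a) (wordComp K n C c a) = wordComp K (m + n) (B ∪ C) c a := by
  have disj : Disjoint B C := Finset.disjoint_left.2 fun x hB hC => (h x hB x hC).false
  simp only [wordComp, extProd_sum, extProd_sharp]
  rw [← Finset.sum_product', ← Finset.sum_product']
  refine Finset.sum_nbij mergeWords (mapsTo_mergeWords disj) (injOn_mergeWords disj)
    (surjOn_mergeWords disj hm) ?_
  rintro ⟨⟨f, g⟩, ρ⟩ hz
  simp only [Finset.mem_product, mem_words] at hz
  obtain ⟨⟨⟨hf, -⟩, hg, -⟩, hρ⟩ := hz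
  rw [shuffle_mul_permProd_sort hρ fun i j => h _ (hf i) _ (hg j), concat_wordTensor disj a hf hg,
    permTensor_wordTensor, mergeWords]

variable (K) in
/-- The sum over all words with content `c` on the alphabet `B`, as an element of `F(A)`. It is the
external product of the `y_{c x, a x}` for `x ∈ B` in increasing order. -/
def wordSum (c : Λ → ℕ) (a : Λ → A) (B : Finset Λ) : FreeQSym K A :=
  DirectSum.of (fun n => Comp K A n) (∑ x ∈ B, c x) (wordComp K (∑ x ∈ B, c x) B c a)

theorem wordSum_eq {c : Λ → ℕ} {B : Finset Λ} (h : ∑ x ∈ B, c x = n) (a : Λ → A) :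
    wordSum K c a B = DirectSum.of (fun n => Comp K A n) n (wordComp K n B c a) := by
  subst h
  rfl

theorem wordSum_mul (c : Λ → ℕ) (a : Λ → A) {B C : Finset Λ} (h : ∀ x ∈ B, ∀ z ∈ C, x < z) :
    wordSum K c a B * wordSum K c a C = wordSum K c a (B ∪ C) := by
  have disj : Disjoint B C := Finset.disjoint_left.2 fun x hB hC => (h x hB x hC).false
  rw [wordSum_eq (Finset.sum_union disj), wordSum, wordSum, of_mul_of, extProd_wordComp h a rfl]

theorem wordSum_empty (c : Λ → ℕ) (a : Λ → A) : wordSum K c a ∅ = 1 := by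
  rw [wordSum_eq Finset.sum_empty, one_eq, wordComp, words_empty, Finset.sum_singleton,
    Subsingleton.elim (Tuple.sort _) 1, wordTensor, Finset.noncommProd_empty,
    PiTensorProduct.one_def, Subsingleton.elim (1 : Fin 0 → A) Fin.elim0]

theorem wordSum_singleton (c : Λ → ℕ) (a : Λ → A) (x : Λ) :
    wordSum K c a {x} = y K (c x) (a x) := by
  have fiber_const : fiber (fun _ : Fin (c x) => x) x = Finset.univ := by simp [fiber]
  rw [wordSum_eq (Finset.sum_singleton _ _), y, wordComp, words_singleton, Finset.sum_singleton,
    Tuple.sort_eq_refl_iff_monotone.2 monotone_const, wordTensor, Finset.noncommProd_singleton,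
    fiber_const, spread_univ]
  rfl

theorem prod_ofFn_wordSum {k : ℕ} (c : Λ → ℕ) (a : Λ → A) {B : Fin k → Finset Λ}
    (hB : ∀ i j, i < j → ∀ x ∈ B i, ∀ z ∈ B j, x < z) :
    (List.ofFn fun i => wordSum K c a (B i)).prod = wordSum K c a (Finset.univ.biUnion B) :=
  prod_ofFn_eq_biUnion (· < ·) (wordSum K c a) (wordSum_empty c a) (fun _ _ => wordSum_mul c a) B hB

theorem prod_ofFn_y {k : ℕ} (c : Λ → ℕ) (a : Λ → A) {e : Fin k → Λ} (he : StrictMono e) :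
    (List.ofFn fun i => y K (c (e i)) (a (e i))).prod = wordSum K c a (Finset.univ.image e) := by
  rw [← Finset.biUnion_singleton, ← prod_ofFn_wordSum c a fun i j hij x hx z hz => by
    rw [Finset.mem_singleton.1 hx, Finset.mem_singleton.1 hz]
    exact he hij]
  simp only [wordSum_singleton]

theorem prod_ofFn_y_eq_wordSum_univ {k : ℕ} (c : Fin k → ℕ) (a : Fin k → A) :
    (List.ofFn fun i => y K (c i) (a i)).prod = wordSum K c a Finset.univ := by
  simpa using prod_ofFn_y (K := K) c a strictMono_id

theorem prod_ofFn_prod_ofFn_y {k l : ℕ} (c : Fin l ×ₗ Fin k → ℕ) (a : Fin l ×ₗ Fin k → A) :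
    (List.ofFn fun j => (List.ofFn fun i => y K (c (toLex (j, i))) (a (toLex (j, i)))).prod).prod =
      wordSum K c a Finset.univ := by
  have column (j : Fin l) : StrictMono fun i : Fin k => toLex (j, i) :=
    fun _ _ h => Prod.Lex.toLex_lt_toLex.2 (Or.inr ⟨rfl, h⟩)
  simp only [fun j => prod_ofFn_y (K := K) c a (column j)]
  rw [prod_ofFn_wordSum]
  · congr 1
    ext z
    simpa using ⟨(ofLex z).1, (ofLex z).2, rfl⟩
  · intro j j' hj x hx z hz
    obtain ⟨i, -, rfl⟩ := Finset.mem_image.1 hx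
    obtain ⟨i', -, rfl⟩ := Finset.mem_image.1 hz
    exact Prod.Lex.toLex_lt_toLex.2 (Or.inl hj)

end WordSum

/-! ### Internal products of sums over words -/

section TwistedProduct

variable {K A : Type*} [CommSemiring K] [Semiring A] [Algebra K A] {n : ℕ}

theorem twistedProd_sharp (σ τ : Equiv.Perm (Fin n)) (t u : ⨂[K]^n A) :
    twistedProd (sharp σ t) (sharp τ u) = sharp (σ * τ) (t * permTensor σ u) := by
  classical
  simp only [twistedProd, coeff_sharp, ite_mul, zero_mul]
  simp [apply_ite]

theorem twistedProd_zero_left (α : Comp K A n) : twistedProd 0 α = 0 := by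
  simp [twistedProd]

theorem twistedProd_zero_right (α : Comp K A n) : twistedProd α 0 = 0 := by
  simp [twistedProd]

theorem twistedProd_add_left (α β γ : Comp K A n) :
    twistedProd (α + β) γ = twistedProd α γ + twistedProd β γ := by
  simp [twistedProd, add_mul, Finset.sum_add_distrib]

theorem twistedProd_add_right (α β γ : Comp K A n) :
    twistedProd α (β + γ) = twistedProd α β + twistedProd α γ := by
  simp [twistedProd, mul_add, Finset.sum_add_distrib]

variable (K A n) in
/-- The product of the twisted group ring `F_n(A)` as a biadditive map. -/
def twistedProdHom : Comp K A n →+ Comp K A n →+ Comp K A n where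
  toFun α :=
    { toFun := twistedProd α
      map_zero' := twistedProd_zero_right α
      map_add' := twistedProd_add_right α }
  map_zero' := AddMonoidHom.ext twistedProd_zero_left
  map_add' α β := AddMonoidHom.ext (twistedProd_add_left α β)

theorem twistedProd_sum {ι κ : Type*} (s : Finset ι) (t : Finset κ) (α : ι → Comp K A n)
    (β : κ → Comp K A n) :
    twistedProd (∑ i ∈ s, α i) (∑ j ∈ t, β j) = ∑ i ∈ s, ∑ j ∈ t, twistedProd (α i) (β j) :=
  map_sum_sum (twistedProdHom K A n) s t α β

theorem internalProd_of_of (α β : Comp K A n) :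
    internalProd (DirectSum.of (fun n => Comp K A n) n α) (DirectSum.of (fun n => Comp K A n) n β) =
      DirectSum.of (fun n => Comp K A n) n (twistedProd α β) :=
  DFinsupp.zipWith_single_single _ _ _ _

theorem internalProd_of_of_of_ne {m : ℕ} (h : m ≠ n) (α : Comp K A m) (β : Comp K A n) :
    internalProd (DirectSum.of (fun n => Comp K A n) m α)
      (DirectSum.of (fun n => Comp K A n) n β) = 0 := by
  refine DFinsupp.ext fun r => (internalProd_apply _ _ r).trans ?_
  obtain rfl | hr := eq_or_ne r m
  · rw [DirectSum.of_eq_of_ne n r β h, twistedProd_zero_right, DFinsupp.zero_apply]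
  · rw [DirectSum.of_eq_of_ne m r α hr, twistedProd_zero_left, DFinsupp.zero_apply]

end TwistedProduct

theorem twistedProd_wordComp {K A Λ Λ' : Type*} [CommSemiring K] [Semiring A] [Bialgebra K A]
    [Coalgebra.IsCocomm K A] [LinearOrder Λ] [LinearOrder Λ'] {n : ℕ} (B : Finset Λ)
    (B' : Finset Λ') (c : Λ → ℕ) (d : Λ' → ℕ) (a : Λ → A) (b : Λ' → A) :
    twistedProd (wordComp K n B c a) (wordComp K n B' d b) =
      ∑ f ∈ words n B c, ∑ g ∈ words n B' d, sharp (Tuple.sort fun r => toLex (g r, f r))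
        (wordTensor K B a f * wordTensor K B' b g) := by
  simp only [wordComp, twistedProd_sum, twistedProd_sharp, permTensor_wordTensor]
  refine Finset.sum_congr rfl fun f _ => ?_
  refine Finset.sum_equiv ((Tuple.sort f).arrowCongr (Equiv.refl Λ'))
    (fun g => (comp_mem_words (Tuple.sort f)⁻¹).symm) fun g _ => ?_
  change _ = sharp (Tuple.sort fun r => toLex ((g ∘ ⇑(Tuple.sort f)⁻¹) r, f r))
    (wordTensor K B a f * wordTensor K B' b (g ∘ ⇑(Tuple.sort f)⁻¹))
  have sorted_order : (g ∘ ⇑(Tuple.sort f)⁻¹) ∘ Tuple.sort f = g := by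
    ext r
    simp
  rw [← sort_mul_sort, sorted_order]

/-! ### Pairs of words with given contents -/

section ContentMatrix

variable {k l n : ℕ}

/-- The matrix whose entry at `(i, j)` counts the positions at which the word `f` has the letter `i`
and the word `g` has the letter `j`. -/
def contentMatrix (f : Fin n → Fin k) (g : Fin n → Fin l) : Matrix (Fin k) (Fin l) ℕ :=
  Matrix.of fun i j => (fiber (fun r => toLex (g r, f r)) (toLex (j, i))).card

theorem sum_contentMatrix_row (f : Fin n → Fin k) (g : Fin n → Fin l) (i : Fin k) :
    ∑ j, contentMatrix f g i j = (fiber f i).card := by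
  rw [Finset.card_eq_sum_card_fiberwise (f := g) (t := Finset.univ) (by simp)]
  simp [contentMatrix, fiber, Finset.filter_filter, and_comm]

theorem sum_contentMatrix_col (f : Fin n → Fin k) (g : Fin n → Fin l) (j : Fin l) :
    ∑ i, contentMatrix f g i j = (fiber g j).card := by
  rw [Finset.card_eq_sum_card_fiberwise (f := f) (t := Finset.univ) (by simp)]
  simp [contentMatrix, fiber, Finset.filter_filter]

theorem contentMatrix_mem_marginMatrices {c : Fin k → ℕ} {d : Fin l → ℕ} {f : Fin n → Fin k}
    {g : Fin n → Fin l} : contentMatrix f g ∈ marginMatrices c d ↔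
      f ∈ words n Finset.univ c ∧ g ∈ words n Finset.univ d := by
  simp [mem_marginMatrices, sum_contentMatrix_row, sum_contentMatrix_col, mem_words]

theorem toLex_mem_words_iff {M : Matrix (Fin k) (Fin l) ℕ} {f : Fin n → Fin k}
    {g : Fin n → Fin l} :
    (fun r => toLex (g r, f r)) ∈ words n Finset.univ (fun z => M (ofLex z).2 (ofLex z).1) ↔
      contentMatrix f g = M := by
  simp only [mem_words, Finset.mem_univ, implies_true, forall_const, true_and, ← Matrix.ext_iff]
  exact ⟨fun h i j => h (toLex (j, i)), fun h z => h (ofLex z).2 (ofLex z).1⟩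

theorem sum_words_sum_words {M : Type*} [AddCommMonoid M] (c : Fin k → ℕ) (d : Fin l → ℕ)
    (F : (Fin n → Fin l ×ₗ Fin k) → M) :
    ∑ f ∈ words n Finset.univ c, ∑ g ∈ words n Finset.univ d, F (fun r => toLex (g r, f r)) =
      ∑ m ∈ marginMatrices c d,
        ∑ h ∈ words n Finset.univ (fun z => m (ofLex z).2 (ofLex z).1), F h := by
  rw [← Finset.sum_product', ← Finset.sum_fiberwise_of_maps_to
    (g := fun z => contentMatrix z.1 z.2) fun z hz =>
      contentMatrix_mem_marginMatrices.2 (Finset.mem_product.1 hz)]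
  refine Finset.sum_congr rfl fun m hm => ?_
  refine Finset.sum_nbij' (fun z r => toLex (z.2 r, z.1 r))
    (fun h => (fun r => (ofLex (h r)).2, fun r => (ofLex (h r)).1)) (fun z hz => ?_)
    (fun h hh => ?_) (fun _ _ => rfl) (fun _ _ => rfl) fun _ _ => rfl
  · exact toLex_mem_words_iff.2 (Finset.mem_filter.1 hz).2
  · have content := toLex_mem_words_iff (f := fun r => (ofLex (h r)).2)
      (g := fun r => (ofLex (h r)).1).1 hh
    rw [← content] at hm
    exact Finset.mem_filter.2
      ⟨Finset.mem_product.2 (contentMatrix_mem_marginMatrices.1 hm), content⟩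

theorem marginMatrices_eq_empty {c : Fin k → ℕ} {d : Fin l → ℕ} (h : ∑ i, c i ≠ ∑ j, d j) :
    marginMatrices c d = ∅ := by
  refine Finset.eq_empty_of_forall_notMem fun M hM => h ?_
  obtain ⟨row, col⟩ := (mem_marginMatrices c d M).1 hM
  simp only [← row, ← col]
  exact Finset.sum_comm

theorem sum_toLex_of_mem_marginMatrices {c : Fin k → ℕ} {d : Fin l → ℕ}
    {M : Matrix (Fin k) (Fin l) ℕ} (hM : M ∈ marginMatrices c d) :
    ∑ z : Fin l ×ₗ Fin k, M (ofLex z).2 (ofLex z).1 = ∑ j, d j := by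
  rw [← toLex.sum_comp, Fintype.sum_prod_type]
  exact Finset.sum_congr rfl fun j _ => ((mem_marginMatrices c d M).1 hM).2 j

end ContentMatrix

section JointWord

variable {K A : Type*} [CommSemiring K] [Semiring A] [Bialgebra K A] [Coalgebra.IsCocomm K A]
  {k l n : ℕ} {a : Fin k → A} {b : Fin l → A}

/-- The product `a_{i(j)} b_{j(i)}` of Sweedler components, as a label of the letter `(j, i)`: the
letters are ordered column by column. -/
def sweedlerMul (p : ∀ i, Sweedler K l (a i)) (q : ∀ j, Sweedler K k (b j))
    (s : ∀ i, Fin (p i).size) (t : ∀ j, Fin (q j).size) : Fin l ×ₗ Fin k → A :=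
  (fun z => (p (ofLex z).2).term (s (ofLex z).2) (ofLex z).1) *
    fun z => (q (ofLex z).1).term (t (ofLex z).1) (ofLex z).2

theorem wordTensor_mul_wordTensor (p : ∀ i, Sweedler K l (a i)) (q : ∀ j, Sweedler K k (b j))
    (f : Fin n → Fin k) (g : Fin n → Fin l) :
    wordTensor K Finset.univ a f * wordTensor K Finset.univ b g =
      ∑ s : (∀ i, Fin (p i).size), ∑ t : (∀ j, Fin (q j).size),
        wordTensor K Finset.univ (sweedlerMul p q s t) fun r => toLex (g r, f r) := by
  rw [wordTensor_eq_sum ((Equiv.prodComm _ _).trans toLex) p f g, wordTensor_eq_sum toLex q g f,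
    Finset.sum_mul_sum]
  simp only [sweedlerMul, wordTensor_mul]
  rfl

theorem twistedProd_wordComp_univ (c : Fin k → ℕ) (d : Fin l → ℕ)
    (p : ∀ i, Sweedler K l (a i)) (q : ∀ j, Sweedler K k (b j)) :
    twistedProd (wordComp K n Finset.univ c a) (wordComp K n Finset.univ d b) =
      ∑ s : (∀ i, Fin (p i).size), ∑ t : (∀ j, Fin (q j).size), ∑ M ∈ marginMatrices c d,
        wordComp K n Finset.univ (fun z => M (ofLex z).2 (ofLex z).1) (sweedlerMul p q s t) := by
  have regroup (s : ∀ i, Fin (p i).size) (t : ∀ j, Fin (q j).size) :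
      ∑ f ∈ words n Finset.univ c, ∑ g ∈ words n Finset.univ d,
        sharp (Tuple.sort fun r => toLex (g r, f r))
          (wordTensor K Finset.univ (sweedlerMul p q s t) fun r => toLex (g r, f r)) =
      ∑ M ∈ marginMatrices c d, wordComp K n Finset.univ (fun z => M (ofLex z).2 (ofLex z).1)
        (sweedlerMul p q s t) :=
    sum_words_sum_words c d fun h =>
      sharp (Tuple.sort h) (wordTensor K Finset.univ (sweedlerMul p q s t) h)
  simp only [twistedProd_wordComp, wordTensor_mul_wordTensor p q, map_sum, ← regroup]
  simp only [← Finset.sum_product' (words n Finset.univ c) (words n Finset.univ d)]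
  rw [Finset.sum_comm]
  exact Finset.sum_congr rfl fun s _ => Finset.sum_comm

end JointWord

end FreeQSym

end

open FreeQSym in
theorem mainTheorem7_general {K A : Type*} [CommSemiring K] [Semiring A] [Bialgebra K A]
    [Coalgebra.IsCocomm K A] {k l : ℕ} (c : Fin k → ℕ) (d : Fin l → ℕ) (a : Fin k → A)
    (b : Fin l → A) (p : ∀ i, Sweedler K l (a i)) (q : ∀ j, Sweedler K k (b j)) :
    internalProd (List.ofFn fun i => y K (c i) (a i)).prod
        (List.ofFn fun j => y K (d j) (b j)).prod =
      ∑ s : (∀ i, Fin (p i).size), ∑ t : (∀ j, Fin (q j).size), ∑ M ∈ marginMatrices c d,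
        (List.ofFn fun j => (List.ofFn fun i =>
          y K (M i j) ((p i).term (s i) j * (q j).term (t j) i)).prod).prod := by
  have product (M : Matrix (Fin k) (Fin l) ℕ) (s : ∀ i, Fin (p i).size)
      (t : ∀ j, Fin (q j).size) :
      (List.ofFn fun j => (List.ofFn fun i =>
        y K (M i j) ((p i).term (s i) j * (q j).term (t j) i)).prod).prod =
      wordSum K (fun z => M (ofLex z).2 (ofLex z).1) (sweedlerMul p q s t) Finset.univ :=
    prod_ofFn_prod_ofFn_y (fun z => M (ofLex z).2 (ofLex z).1) (sweedlerMul p q s t)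
  simp only [product]
  rw [prod_ofFn_y_eq_wordSum_univ, prod_ofFn_y_eq_wordSum_univ]
  by_cases h : ∑ i, c i = ∑ j, d j
  · rw [wordSum_eq h, wordSum, internalProd_of_of, twistedProd_wordComp_univ c d p q]
    simp only [map_sum]
    refine Finset.sum_congr rfl fun s _ => Finset.sum_congr rfl fun t _ => ?_
    exact Finset.sum_congr rfl fun M hM => (wordSum_eq (sum_toLex_of_mem_marginMatrices hM) _).symm
  · simp only [marginMatrices_eq_empty h, Finset.sum_empty, Finset.sum_const_zero]
    exact internalProd_of_of_of_ne h _ _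

theorem mainTheorem7 {K A : Type*} [CommRing K] [Ring A] [Bialgebra K A] [Coalgebra.IsCocomm K A]
    {n : ℕ} (hn : 0 < n) (c d : Composition n)
    (a : Fin c.length → A) (b : Fin d.length → A)
    (p : ∀ i, FreeQSym.Sweedler K d.length (a i))
    (q : ∀ j, FreeQSym.Sweedler K c.length (b j)) :
    FreeQSym.internalProd
        (List.ofFn fun i => FreeQSym.y K (c.blocksFun i) (a i)).prod
        (List.ofFn fun j => FreeQSym.y K (d.blocksFun j) (b j)).prod =
      ∑ s : (∀ i, Fin (p i).size), ∑ t : (∀ j, Fin (q j).size),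
        ∑ M ∈ FreeQSym.marginMatrices c.blocksFun d.blocksFun,
          (List.ofFn fun j => (List.ofFn fun i =>
            FreeQSym.y K (M i j) ((p i).term (s i) j * (q j).term (t j) i)).prod).prod := by
  exact mainTheorem7_general c.blocksFun d.blocksFun a b p q
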